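/- **Theorem 1.** Let $d\ge 2$, $0\le\rho<1$, and let $Q\in O(d)$ be a $d\times d$ orthogonal matrix with transpose $Q'$. Let $S^{d-1}=\{x\in\mathbb{R}^d:\|x\|=1\}$ carry its surface measure $\sigma$, with total mass $A_{d-1}=2\pi^{d/2}/\Gamma(d/2)$. Let $(U,V)\sim BS_d(\rho Q)$, i.e. $(U,V)$ is a random vector with values in $S^{d-1}\times S^{d-1}$ which has, with respect to $\sigma\otimes\sigma$, the density $$c(u,v)=\frac{1}{A_{d-1}^2}\,\frac{1-\rho^2}{(1-2\rho\,u'Qv+\rho^2)^{d/2}},\qquad u,v\in S^{d-1}.$$ Let $D=\{\zeta\in\mathbb{R}^d:\|\zeta\|<1\}$ and let $f$ be real-valued, $C^2$ in $D$, continuous on $\overline D$ and harmonic in $D$, i.e. $\sum_{i=1}^d \partial^2 f/\partial x_i^2=0$ in $D$. Then $f(U)$ and $f(V)$ are integrable, and $$E\{f(V)\mid U=u\}=f(\rho Q'u),\qquad E\{f(U)\mid V=v\}=f(\rho Qv).$$ These hold in both usual senses: for every $u\in S^{d-1}$ (respectively every $v\in S^{d-1}$) when the left-hand side is the integral of $f$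 against the conditional density, $c(u,\cdot)/\int c(u,w)\,d\sigma(w)$ (respectively $c(\cdot,v)/\int c(w,v)\,d\sigma(w)$); and, as conditional expectations given the generated $\sigma$-algebras, $E\{f(V)\mid\sigma(U)\}=f(\rho Q'U)$ and $E\{f(U)\mid\sigma(V)\}=f(\rho QV)$ almost surely. In particular $E f(U)=E f(V)=f(0)$. -/

import Mathlib

open MeasureTheory Metric

/-- `ℝ^d` with its Euclidean norm. -/
abbrev EucSpace (d : ℕ) : Type := EuclideanSpace ℝ (Fin d)

/-- The unit sphere `S^{d-1}` of `ℝ^d`, as a type. -/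
abbrev UnitSphere (d : ℕ) : Type := sphere (0 : EucSpace d) 1

/-- The surface measure on `S^{d-1}` (not normalized; its total mass is `sphereArea d`). -/
noncomputable def surfaceMeasure (d : ℕ) : Measure (UnitSphere d) :=
  (volume : Measure (EucSpace d)).toSphere

/-- `A_{d-1} = 2 π^{d/2} / Γ(d/2)`, the surface area of `S^{d-1}`. -/
noncomputable def sphereArea (d : ℕ) : ℝ :=
  2 * Real.pi ^ ((d : ℝ) / 2) / Real.Gamma ((d : ℝ) / 2)

/-- The matrix-vector product `M x` in `ℝ^d`. -/
noncomputable def matMul {d : ℕ} (M : Matrix (Fin d) (Fin d) ℝ) (x : EucSpace d) : EucSpace d :=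
  WithLp.toLp 2 (M.mulVec x.ofLp)

/-- The density `c(u, v) = A_{d-1}^{-2} (1 - ρ²) / (1 - 2 ρ u'Qv + ρ²)^{d/2}` of `BS_d(ρQ)`. -/
noncomputable def bsDensity {d : ℕ} (ρ : ℝ) (Q : Matrix (Fin d) (Fin d) ℝ)
    (u v : UnitSphere d) : ℝ :=
  1 / sphereArea d ^ 2 *
    ((1 - ρ ^ 2) /
      (1 - 2 * ρ * inner ℝ (u : EucSpace d) (matMul Q (v : EucSpace d)) + ρ ^ 2) ^ ((d : ℝ) / 2))

/-- `(U, V) ~ BS_d(ρQ)`: `U`, `V` are random unit vectors and the joint law of `(U, V)` has the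
density `bsDensity ρ Q` with respect to the product of the surface measures. -/
structure HasBSLaw {Ω : Type*} [MeasurableSpace Ω] (P : Measure Ω) {d : ℕ}
    (U V : Ω → UnitSphere d) (ρ : ℝ) (Q : Matrix (Fin d) (Fin d) ℝ) : Prop where
  measurable_fst : Measurable U
  measurable_snd : Measurable V
  law : P.map (fun ω => (U ω, V ω)) =
    ((surfaceMeasure d).prod (surfaceMeasure d)).withDensity
      (fun p => ENNReal.ofReal (bsDensity ρ Q p.1 p.2))

/-- For a joint density `c(x, y)` on `S^{d-1} × S^{d-1}`, the conditional density of the second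
variable given that the first one is `x`: the joint density over the marginal one. -/
noncomputable def condDensity {d : ℕ} (c : UnitSphere d → UnitSphere d → ℝ)
    (x y : UnitSphere d) : ℝ :=
  c x y / ∫ z, c x z ∂(surfaceMeasure d)

/-- `E{g(Y) | X = x}` when `(X, Y)` has the joint density `c`: the integral of `g` against the
conditional density of `Y` given `X = x`. -/
noncomputable def condMean {d : ℕ} (c : UnitSphere d → UnitSphere d → ℝ)
    (g : UnitSphere d → ℝ) (x : UnitSphere d) : ℝ :=
  ∫ y, g y * condDensity c x y ∂(surfaceMeasure d)

/-! Since `Q'` is an isometry, `1 - 2ρ u'Qv + ρ²` equals `|ρQ'u - v|²`, so up to the factor `A⁻²`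
(`A` the area of the sphere) the density `c(u, ·)` is the Poisson kernel of the unit ball with pole
at the interior point `ρQ'u` (`bsDensity_eq_poissonKer`). Everything then reduces to Poisson's
formula for harmonic functions continuous up to the boundary (`poissonInt_eq_of_harmonic`). With `f
= 1` it makes the marginals uniform; at the centre it gives the means.

Poisson's formula comes from uniqueness in the Dirichlet problem. The kernel is harmonic in `x`,
hence so is the Poisson integral; it has the right boundary values because the kernel has constant
mass and concentrates at the boundary point approached; the weak maximum principle on balls then
identifies it with `A f`.

Harmonicity is used in a weak form: only second derivatives along the coordinate axes at a point,
which is all that the second-derivative test needs. Thus the Poisson integral need not be shown to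
be `C²`. -/

open Filter Topology Set

/-! ### Second derivatives along lines -/

/-- `t ↦ u (x + t v)` is twice differentiable at `0` with second derivative `a`. -/
def HasSecondDerivAlong {E : Type*} [NormedAddCommGroup E] [NormedSpace ℝ E]
    (u : E → ℝ) (x v : E) (a : ℝ) : Prop :=
  ∃ g' : ℝ → ℝ, (∀ᶠ t in 𝓝 (0 : ℝ), HasDerivAt (fun t : ℝ => u (x + t • v)) (g' t) t) ∧
    HasDerivAt g' a 0

namespace HasSecondDerivAlong

variable {E : Type*} [NormedAddCommGroup E] [NormedSpace ℝ E] {u w : E → ℝ} {x v : E} {a b : ℝ}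

theorem add (hu : HasSecondDerivAlong u x v a) (hw : HasSecondDerivAlong w x v b) :
    HasSecondDerivAlong (fun y => u y + w y) x v (a + b) := by
  obtain ⟨g, hg, hg'⟩ := hu
  obtain ⟨k, hk, hk'⟩ := hw
  refine ⟨fun t => g t + k t, ?_, hg'.add hk'⟩
  filter_upwards [hg, hk] with t h1 h2 using h1.add h2

theorem const_mul (c : ℝ) (hu : HasSecondDerivAlong u x v a) :
    HasSecondDerivAlong (fun y => c * u y) x v (c * a) := by
  obtain ⟨g, hg, hg'⟩ := hu
  refine ⟨fun t => c * g t, ?_, hg'.const_mul c⟩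
  filter_upwards [hg] with t h1 using h1.const_mul c

/-- If `a > 0`, the second-derivative test would make `0` a local minimum as well, so the function
would be constant near `0` along the line, forcing `a = 0`. -/
theorem nonpos_of_isLocalMax (hu : HasSecondDerivAlong u x v a) (h : IsLocalMax u x) :
    a ≤ 0 := by
  obtain ⟨g, hg, hg'⟩ := hu
  set k : ℝ → ℝ := fun t => u (x + t • v) with hk
  have hcont : ContinuousAt (fun t : ℝ => x + t • v) 0 := by fun_prop
  have hmax : IsLocalMax k 0 := by
    have h0 : Tendsto (fun t : ℝ => x + t • v) (𝓝 0) (𝓝 x) := by simpa using hcont.tendsto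
    filter_upwards [h0.eventually h] with t ht
    simpa [hk] using ht
  have hderiv : deriv k =ᶠ[𝓝 0] g := by
    filter_upwards [hg] with t ht using ht.deriv
  have hdd : deriv (deriv k) 0 = a := by rw [hderiv.deriv_eq, hg'.deriv]
  by_contra! ha
  have hmin : IsLocalMin k 0 :=
    isLocalMin_of_deriv_deriv_pos (by rw [hdd]; exact ha) hmax.deriv_eq_zero
      hg.self_of_nhds.continuousAt
  have hconst : k =ᶠ[𝓝 0] fun _ => k 0 := by
    filter_upwards [hmax, hmin] with t h1 h2 using le_antisymm h1 h2
  have hz : deriv k =ᶠ[𝓝 0] fun _ => 0 := by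
    filter_upwards [hconst.eventuallyEq_nhds] with t ht
    rw [ht.deriv_eq, deriv_const]
  rw [hz.deriv_eq, deriv_const] at hdd
  exact ha.ne hdd

end HasSecondDerivAlong

theorem hasSecondDerivAlong_norm_sq {E : Type*} [NormedAddCommGroup E] [InnerProductSpace ℝ E]
    (x v : E) : HasSecondDerivAlong (fun y => ‖y‖ ^ 2) x v (2 * ‖v‖ ^ 2) := by
  have hl : ∀ t : ℝ, HasDerivAt (fun t : ℝ => x + t • v) v t := fun t => by
    simpa using ((hasDerivAt_id t).smul_const v).const_add x
  refine ⟨fun t => 2 * inner ℝ (x + t • v) v, .of_forall fun t => (hl t).norm_sq, ?_⟩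
  simpa using ((hl 0).inner ℝ (hasDerivAt_const 0 v)).const_mul 2

theorem hasSecondDerivAlong_of_contDiffAt {E : Type*} [NormedAddCommGroup E] [NormedSpace ℝ E]
    {u : E → ℝ} {x : E} (hu : ContDiffAt ℝ 2 u x) (v : E) :
    HasSecondDerivAlong u x v (iteratedFDeriv ℝ 2 u x ![v, v]) := by
  have hl : ∀ t : ℝ, HasDerivAt (fun t : ℝ => x + t • v) v t := fun t => by
    simpa using ((hasDerivAt_id t).smul_const v).const_add x
  have hl0 : Tendsto (fun t : ℝ => x + t • v) (𝓝 0) (𝓝 x) := by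
    simpa using (hl 0).continuousAt.tendsto
  refine ⟨fun t => fderiv ℝ u (x + t • v) v, ?_, ?_⟩
  · filter_upwards [hl0.eventually (hu.eventually (by simp))] with t ht
    exact (ht.differentiableAt (by simp)).hasFDerivAt.comp_hasDerivAt t (hl t)
  · have h1 : HasFDerivAt (fderiv ℝ u) (fderiv ℝ (fderiv ℝ u) x) x :=
      ((hu.fderiv_right (m := 1) (by norm_num)).differentiableAt (by simp)).hasFDerivAt
    have h2 : HasDerivAt (fun t : ℝ => fderiv ℝ u (x + t • v)) (fderiv ℝ (fderiv ℝ u) x v) 0 :=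
      h1.comp_hasDerivAt_of_eq (0 : ℝ) (hl 0) (by simp)
    rw [iteratedFDeriv_two_apply]
    exact (ContinuousLinearMap.apply ℝ ℝ v).hasFDerivAt.comp_hasDerivAt (0 : ℝ) h2

/-! ### Pointwise Laplacian and the weak maximum principle -/

/-- The unmixed second derivatives of `u` at `x` along the coordinate axes exist and add up
to `0`. -/
def HasZeroLaplacianAt {d : ℕ} (u : EucSpace d → ℝ) (x : EucSpace d) : Prop :=
  ∃ a : Fin d → ℝ, (∀ i, HasSecondDerivAlong u x (EuclideanSpace.single i 1) (a i)) ∧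
    ∑ i, a i = 0

namespace HasZeroLaplacianAt

variable {d : ℕ} {u w : EucSpace d → ℝ} {x : EucSpace d}

theorem add (hu : HasZeroLaplacianAt u x) (hw : HasZeroLaplacianAt w x) :
    HasZeroLaplacianAt (fun y => u y + w y) x := by
  obtain ⟨a, ha, ha0⟩ := hu
  obtain ⟨b, hb, hb0⟩ := hw
  exact ⟨fun i => a i + b i, fun i => (ha i).add (hb i), by
    rw [Finset.sum_add_distrib, ha0, hb0, add_zero]⟩

theorem const_mul (c : ℝ) (hu : HasZeroLaplacianAt u x) :
    HasZeroLaplacianAt (fun y => c * u y) x := by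
  obtain ⟨a, ha, ha0⟩ := hu
  exact ⟨fun i => c * a i, fun i => (ha i).const_mul c, by rw [← Finset.mul_sum, ha0, mul_zero]⟩

theorem of_laplacian_eq_zero (hu : ContDiffAt ℝ 2 u x) (h : Laplacian.laplacian u x = 0) :
    HasZeroLaplacianAt u x := by
  refine ⟨_, fun i => hasSecondDerivAlong_of_contDiffAt hu _, ?_⟩
  rw [InnerProductSpace.laplacian_eq_iteratedFDeriv_orthonormalBasis u
    (EuclideanSpace.basisFun (Fin d) ℝ)] at h
  simpa using h

end HasZeroLaplacianAt

/-- The weak maximum principle on balls. -/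
theorem le_of_hasZeroLaplacianAt_of_le_sphere {d : ℕ} (hd : 0 < d) {u : EucSpace d → ℝ} {r M : ℝ}
    (hcont : ContinuousOn u (closedBall 0 r))
    (hharm : ∀ x ∈ ball (0 : EucSpace d) r, HasZeroLaplacianAt u x)
    (hM : ∀ x ∈ sphere (0 : EucSpace d) r, u x ≤ M) {x : EucSpace d} (hx : x ∈ closedBall 0 r) :
    u x ≤ M := by
  refine le_of_forall_pos_le_add fun δ hδ => ?_
  have hr : 0 ≤ r := nonneg_of_mem_closedBall hx
  -- Adding `ε|y|²` makes the Laplacian strictly positive, equal to `2dε`, which excludes an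
  -- interior maximum; the price is at most `ε r² ≤ δ`. The `+ 1` covers `r = 0`.
  obtain ⟨ε, hε, hεδ⟩ : ∃ ε > 0, ε * r ^ 2 ≤ δ := by
    refine ⟨δ / (r ^ 2 + 1), by positivity, ?_⟩
    rw [div_mul_eq_mul_div, div_le_iff₀ (by positivity)]
    nlinarith
  have hwc : ContinuousOn (fun y => u y + ε * ‖y‖ ^ 2) (closedBall 0 r) :=
    hcont.add (by fun_prop)
  obtain ⟨z, hz, hzmax⟩ := (isCompact_closedBall (0 : EucSpace d) r).exists_isMaxOn ⟨x, hx⟩ hwc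
  have hxz : u x + ε * ‖x‖ ^ 2 ≤ u z + ε * ‖z‖ ^ 2 := hzmax hx
  have hzs : z ∈ sphere (0 : EucSpace d) r := by
    by_contra hns
    have hzb : z ∈ ball (0 : EucSpace d) r := by
      rw [mem_ball]
      exact lt_of_le_of_ne (mem_closedBall.1 hz) hns
    obtain ⟨a, ha, ha0⟩ := hharm z hzb
    have hloc : IsLocalMax (fun y => u y + ε * ‖y‖ ^ 2) z :=
      hzmax.isLocalMax (mem_of_superset (isOpen_ball.mem_nhds hzb) ball_subset_closedBall)
    have hle : ∀ i, a i + ε * 2 ≤ 0 := fun i => by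
      simpa using ((ha i).add ((hasSecondDerivAlong_norm_sq z _).const_mul ε)).nonpos_of_isLocalMax
        hloc
    have hsum : ∑ i, (a i + ε * 2) ≤ 0 := Finset.sum_nonpos fun i _ => hle i
    rw [Finset.sum_add_distrib, ha0] at hsum
    have hd' : (0 : ℝ) < d := by exact_mod_cast hd
    have : 0 < (d : ℝ) * (ε * 2) := by positivity
    simp at hsum
    linarith
  have hz' : ‖z‖ = r := by simpa using hzs
  have := hM z hzs
  rw [hz'] at hxz
  nlinarith [sq_nonneg ‖x‖]

/-- Differentiation under an integral over a compact space. -/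
theorem hasDerivAt_integral_of_continuousOn {K : Type*} [TopologicalSpace K] [CompactSpace K]
    [MeasurableSpace K] [OpensMeasurableSpace K] [SecondCountableTopology K]
    {μ : Measure K} [IsFiniteMeasure μ] {g g' : ℝ → K → ℝ} {ε : ℝ}
    (hg : ContinuousOn (Function.uncurry g) (Icc (-ε) ε ×ˢ univ))
    (hg' : ContinuousOn (Function.uncurry g') (Icc (-ε) ε ×ˢ univ))
    (hderiv : ∀ t ∈ Ioo (-ε) ε, ∀ y, HasDerivAt (fun t => g t y) (g' t y) t)
    {t : ℝ} (ht : t ∈ Ioo (-ε) ε) :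
    HasDerivAt (fun t => ∫ y, g t y ∂μ) (∫ y, g' t y ∂μ) t := by
  have hsec : ∀ {k : ℝ → K → ℝ}, ContinuousOn (Function.uncurry k) (Icc (-ε) ε ×ˢ univ) →
      ∀ t ∈ Ioo (-ε) ε, Continuous (k t) := fun {k} hk t ht => by
    rw [← continuousOn_univ]
    exact hk.comp (f := fun y => (t, y)) (by fun_prop)
      fun y _ => ⟨Ioo_subset_Icc_self ht, mem_univ _⟩
  obtain ⟨C, hC⟩ := (isCompact_Icc.prod isCompact_univ).exists_bound_of_continuousOn hg'
  refine (hasDerivAt_integral_of_dominated_loc_of_deriv_le (bound := fun _ => C)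
    (isOpen_Ioo.mem_nhds ht) ?_ ?_ ?_ ?_ (integrable_const C) ?_).2
  · filter_upwards [isOpen_Ioo.mem_nhds ht] with s hs
    exact (hsec hg s hs).aestronglyMeasurable
  · exact (hsec hg t ht).integrable_of_hasCompactSupport
      (HasCompactSupport.of_compactSpace _)
  · exact (hsec hg' t ht).aestronglyMeasurable
  · exact .of_forall fun y s hs => hC (s, y) ⟨Ioo_subset_Icc_self hs, mem_univ _⟩
  · exact .of_forall fun y s hs => hderiv s hs y

/-! ### The Poisson kernel and its harmonicity -/

section Kernel

variable {E : Type*} [NormedAddCommGroup E]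

/-- The unnormalized Poisson kernel `(1 - |x|²) / |x - y|^{2s}` of the unit ball of `ℝ^{2s}`. -/
noncomputable def poissonKer (s : ℝ) (x y : E) : ℝ :=
  (1 - ‖x‖ ^ 2) * (‖x - y‖ ^ 2) ^ (-s)

theorem poissonKer_nonneg {s : ℝ} {x : E} (hx : ‖x‖ ≤ 1) (y : E) : 0 ≤ poissonKer s x y := by
  have : ‖x‖ ^ 2 ≤ 1 := pow_le_one₀ (norm_nonneg x) hx
  exact mul_nonneg (by linarith) (by positivity)

theorem continuousOn_norm_sub_sq_rpow (s : ℝ) :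
    ContinuousOn (fun p : E × E => (‖p.1 - p.2‖ ^ 2) ^ s) {p | p.1 ≠ p.2} := by
  refine ContinuousOn.rpow_const (by fun_prop) fun p hp => Or.inl ?_
  have := norm_pos_iff.2 (sub_ne_zero.2 hp)
  positivity

theorem continuousOn_poissonKer (s : ℝ) :
    ContinuousOn (fun p : E × E => poissonKer s p.1 p.2) {p | p.1 ≠ p.2} :=
  ContinuousOn.mul (by fun_prop) (continuousOn_norm_sub_sq_rpow _)

variable [InnerProductSpace ℝ E]

/-- The derivative of `poissonKer s · y` in the direction `v`. -/
noncomputable def poissonKerDeriv (s : ℝ) (v x y : E) : ℝ :=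
  -2 * inner ℝ x v * (‖x - y‖ ^ 2) ^ (-s)
    - 2 * s * (1 - ‖x‖ ^ 2) * inner ℝ (x - y) v * (‖x - y‖ ^ 2) ^ (-s - 1)

/-- The second derivative of `poissonKer s · y` in the direction `v`. -/
noncomputable def poissonKerDeriv₂ (s : ℝ) (v x y : E) : ℝ :=
  -2 * ‖v‖ ^ 2 * (‖x - y‖ ^ 2) ^ (-s)
    + 8 * s * inner ℝ x v * inner ℝ (x - y) v * (‖x - y‖ ^ 2) ^ (-s - 1)
    - 2 * s * (1 - ‖x‖ ^ 2) * ‖v‖ ^ 2 * (‖x - y‖ ^ 2) ^ (-s - 1)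
    + 4 * s * (s + 1) * (1 - ‖x‖ ^ 2) * inner ℝ (x - y) v ^ 2 * (‖x - y‖ ^ 2) ^ (-s - 2)

theorem continuousOn_poissonKerDeriv (s : ℝ) (v : E) :
    ContinuousOn (fun p : E × E => poissonKerDeriv s v p.1 p.2) {p | p.1 ≠ p.2} :=
  (ContinuousOn.mul (by fun_prop) (continuousOn_norm_sub_sq_rpow _)).sub
    (ContinuousOn.mul (by fun_prop) (continuousOn_norm_sub_sq_rpow _))

theorem continuousOn_poissonKerDeriv₂ (s : ℝ) (v : E) :
    ContinuousOn (fun p : E × E => poissonKerDeriv₂ s v p.1 p.2) {p | p.1 ≠ p.2} :=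
  (((ContinuousOn.mul (by fun_prop) (continuousOn_norm_sub_sq_rpow _)).add
    (ContinuousOn.mul (by fun_prop) (continuousOn_norm_sub_sq_rpow _))).sub
    (ContinuousOn.mul (by fun_prop) (continuousOn_norm_sub_sq_rpow _))).add
    (ContinuousOn.mul (by fun_prop) (continuousOn_norm_sub_sq_rpow _))

theorem hasDerivAt_norm_sub_sq_rpow (s : ℝ) {x v y : E} {t : ℝ} (h : x + t • v ≠ y) :
    HasDerivAt (fun t : ℝ => (‖x + t • v - y‖ ^ 2) ^ s)
      (2 * s * inner ℝ (x + t • v - y) v * (‖x + t • v - y‖ ^ 2) ^ (s - 1)) t := by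
  have hl : HasDerivAt (fun t : ℝ => x + t • v - y) v t := by
    simpa using (((hasDerivAt_id t).smul_const v).const_add x).sub_const y
  have hpos := norm_pos_iff.2 (sub_ne_zero.2 h)
  refine (hl.norm_sq.rpow_const (p := s) (Or.inl (by positivity))).congr_deriv ?_
  ring

theorem hasDerivAt_poissonKer (s : ℝ) {x v y : E} {t : ℝ} (h : x + t • v ≠ y) :
    HasDerivAt (fun t : ℝ => poissonKer s (x + t • v) y)
      (poissonKerDeriv s v (x + t • v) y) t := by
  have hl : HasDerivAt (fun t : ℝ => x + t • v) v t := by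
    simpa using ((hasDerivAt_id t).smul_const v).const_add x
  refine ((hl.norm_sq.const_sub 1).mul (hasDerivAt_norm_sub_sq_rpow (-s) h)).congr_deriv ?_
  simp only [poissonKerDeriv]
  ring

theorem hasDerivAt_poissonKerDeriv (s : ℝ) {x v y : E} {t : ℝ} (h : x + t • v ≠ y) :
    HasDerivAt (fun t : ℝ => poissonKerDeriv s v (x + t • v) y)
      (poissonKerDeriv₂ s v (x + t • v) y) t := by
  have hl : HasDerivAt (fun t : ℝ => x + t • v) v t := by
    simpa using ((hasDerivAt_id t).smul_const v).const_add x
  have h1 := ((hl.inner ℝ (hasDerivAt_const t v)).const_mul (-2)).mul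
    (hasDerivAt_norm_sub_sq_rpow (-s) h)
  have h2 := (((hl.norm_sq.const_sub 1).const_mul (2 * s)).mul
    ((hl.sub_const y).inner ℝ (hasDerivAt_const t v))).mul
    (hasDerivAt_norm_sub_sq_rpow (-s - 1) h)
  refine (h1.sub h2).congr_deriv ?_
  simp only [poissonKerDeriv₂, inner_zero_right, zero_add, real_inner_self_eq_norm_sq,
    show -s - 1 - 1 = -s - 2 by ring, Pi.mul_apply]
  ring

end Kernel

/-- With `q = |x - y|²`, the sum is `q ^ (-s - 2)` times a polynomial in `|x|²`, `q` and `x·y`. It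
vanishes once `d = 2s` is used and `|y| = 1` serves to eliminate `x·y`. -/
theorem sum_poissonKerDeriv₂_eq_zero {d : ℕ} {x y : EucSpace d} (hy : ‖y‖ = 1) (hxy : x ≠ y) :
    ∑ i, poissonKerDeriv₂ ((d : ℝ) / 2) (EuclideanSpace.single i 1) x y = 0 := by
  have hpos : 0 < ‖x - y‖ ^ 2 := by
    have := norm_pos_iff.2 (sub_ne_zero.2 hxy)
    positivity
  set s : ℝ := (d : ℝ) / 2 with hs
  set q := ‖x - y‖ ^ 2 with hq
  have hd : (d : ℝ) = 2 * s := by rw [hs]; ring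
  have e1 : q ^ (-s) = q ^ (-s - 2) * q ^ 2 := by
    rw [← Real.rpow_add_natCast hpos.ne']
    congr 1
    push_cast
    ring
  have e2 : q ^ (-s - 1) = q ^ (-s - 2) * q := by
    rw [← Real.rpow_add_one hpos.ne']
    congr 1
    ring
  have hxx : ∑ i, x i * x i = ‖x‖ ^ 2 := by
    rw [EuclideanSpace.real_norm_sq_eq]
    simp_rw [sq]
  have hww : ∑ i, (x i - y i) ^ 2 = q := by
    rw [hq, EuclideanSpace.real_norm_sq_eq]
    simp
  have hxw : ∑ i, x i * (x i - y i) = ‖x‖ ^ 2 - inner ℝ x y := by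
    simp_rw [mul_sub]
    rw [Finset.sum_sub_distrib, hxx, PiLp.inner_apply]
    simp [mul_comm]
  have hqe : q = ‖x‖ ^ 2 - 2 * inner ℝ x y + 1 := by
    rw [hq, norm_sub_sq_real, hy]
    norm_num
  have hterm : ∀ i, poissonKerDeriv₂ s (EuclideanSpace.single i 1) x y =
      q ^ (-s - 2) * (-2 * q ^ 2 - 2 * s * (1 - ‖x‖ ^ 2) * q
        + 8 * s * q * (x i * (x i - y i))
        + 4 * s * (s + 1) * (1 - ‖x‖ ^ 2) * (x i - y i) ^ 2) := fun i => by
    simp only [poissonKerDeriv₂, ← hq, e1, e2]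
    simp [EuclideanSpace.inner_single_right]
    ring
  simp_rw [hterm]
  rw [← Finset.mul_sum, Finset.sum_add_distrib, Finset.sum_add_distrib, ← Finset.mul_sum,
    ← Finset.mul_sum, hww, hxw]
  simp only [Finset.sum_const, Finset.card_univ, Fintype.card_fin, nsmul_eq_mul, hd]
  have : inner ℝ x y = (‖x‖ ^ 2 + 1 - q) / 2 := by rw [hqe]; ring
  rw [this]
  ring

/-! ### Harmonicity of the Poisson integral -/

/-- The Poisson integral of a function on the sphere, without the normalizing factor. -/
noncomputable def poissonInt {d : ℕ} (φ : UnitSphere d → ℝ) (x : EucSpace d) : ℝ :=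
  ∫ y, poissonKer ((d : ℝ) / 2) x y * φ y ∂(surfaceMeasure d)

instance (d : ℕ) : IsFiniteMeasure (surfaceMeasure d) := by
  unfold surfaceMeasure
  infer_instance

theorem ne_coe_unitSphere {d : ℕ} {x : EucSpace d} (hx : ‖x‖ < 1) (y : UnitSphere d) :
    x ≠ (y : EucSpace d) := by
  rintro rfl
  simp at hx

theorem continuous_poissonKer {d : ℕ} (s : ℝ) {x : EucSpace d} (hx : ‖x‖ < 1) :
    Continuous fun y : UnitSphere d => poissonKer s x y := by
  rw [← continuousOn_univ]
  exact (continuousOn_poissonKer s).comp (f := fun y : UnitSphere d => (x, (y : EucSpace d)))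
    (by fun_prop) fun y _ => ne_coe_unitSphere hx y

theorem continuousOn_poissonInt {d : ℕ} {φ : UnitSphere d → ℝ} (hφ : Continuous φ) {r : ℝ}
    (hr : r < 1) : ContinuousOn (poissonInt φ) (closedBall 0 r) := by
  rw [continuousOn_iff_continuous_domRestrict]
  have hlt : ∀ x : closedBall (0 : EucSpace d) r, ‖(x : EucSpace d)‖ < 1 := fun x =>
    (mem_closedBall_zero_iff.1 x.2).trans_lt hr
  have hc : Continuous fun p : closedBall (0 : EucSpace d) r × UnitSphere d =>
      poissonKer ((d : ℝ) / 2) (p.1 : EucSpace d) p.2 * φ p.2 := by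
    refine Continuous.mul ?_ (by fun_prop)
    rw [← continuousOn_univ]
    exact (continuousOn_poissonKer _).comp
      (f := fun p : closedBall (0 : EucSpace d) r × UnitSphere d =>
        ((p.1 : EucSpace d), (p.2 : EucSpace d)))
      (by fun_prop) fun p _ => ne_coe_unitSphere (hlt p.1) p.2
  simpa [Set.domRestrict_def, poissonInt] using
    continuous_parametric_integral_of_continuous (μ := surfaceMeasure d) hc isCompact_univ

theorem hasZeroLaplacianAt_poissonInt {d : ℕ} {φ : UnitSphere d → ℝ} (hφ : Continuous φ)
    {x : EucSpace d} (hx : ‖x‖ < 1) : HasZeroLaplacianAt (poissonInt φ) x := by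
  set s : ℝ := (d : ℝ) / 2 with hs
  -- Moving by at most half the distance to the sphere keeps the point away from the singularity of
  -- the kernel, so differentiation under the integral is allowed.
  have hlt : ∀ t ∈ Icc (-((1 - ‖x‖) / 2)) ((1 - ‖x‖) / 2), ∀ v : EucSpace d, ‖v‖ = 1 →
      ‖x + t • v‖ < 1 := fun t ht v hv => by
    have h1 : ‖t • v‖ ≤ (1 - ‖x‖) / 2 := by
      rw [norm_smul, hv, mul_one]
      exact abs_le.2 ht
    linarith [norm_add_le x (t • v)]
  have hcont : ∀ {k : EucSpace d → EucSpace d → ℝ} {v : EucSpace d}, ‖v‖ = 1 →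
      ContinuousOn (fun p : EucSpace d × EucSpace d => k p.1 p.2) {p | p.1 ≠ p.2} →
      ContinuousOn (Function.uncurry fun (t : ℝ) (y : UnitSphere d) => k (x + t • v) y * φ y)
        (Icc (-((1 - ‖x‖) / 2)) ((1 - ‖x‖) / 2) ×ˢ univ) := fun {k v} hv hk => by
    refine ContinuousOn.mul ?_ (by fun_prop)
    exact hk.comp (f := fun p : ℝ × UnitSphere d => (x + p.1 • v, (p.2 : EucSpace d)))
      (by fun_prop) fun p hp => ne_coe_unitSphere (hlt p.1 hp.1 v hv) p.2
  have h0 : (0 : ℝ) ∈ Ioo (-((1 - ‖x‖) / 2)) ((1 - ‖x‖) / 2) := by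
    constructor <;> linarith
  refine ⟨fun i => ∫ y, poissonKerDeriv₂ s (EuclideanSpace.single i 1) x y * φ y
    ∂(surfaceMeasure d), fun i => ?_, ?_⟩
  · have hv : ‖(EuclideanSpace.single i 1 : EucSpace d)‖ = 1 := by simp
    set v : EucSpace d := EuclideanSpace.single i 1
    refine ⟨fun t => ∫ y, poissonKerDeriv s v (x + t • v) y * φ y ∂(surfaceMeasure d), ?_, ?_⟩
    · filter_upwards [isOpen_Ioo.mem_nhds h0] with t ht
      exact hasDerivAt_integral_of_continuousOn (hcont hv (continuousOn_poissonKer s))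
        (hcont hv (continuousOn_poissonKerDeriv s v))
        (fun t ht y => (hasDerivAt_poissonKer s (ne_coe_unitSphere
          (hlt t (Ioo_subset_Icc_self ht) v hv) y)).mul_const _) ht
    · have := hasDerivAt_integral_of_continuousOn (μ := surfaceMeasure d)
        (hcont hv (continuousOn_poissonKerDeriv s v))
        (hcont hv (continuousOn_poissonKerDeriv₂ s v))
        (fun t ht y => (hasDerivAt_poissonKerDeriv s (ne_coe_unitSphere
          (hlt t (Ioo_subset_Icc_self ht) v hv) y)).mul_const _) h0
      simpa using this
  · rw [← integral_finsetSum]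
    · rw [← integral_zero (UnitSphere d) ℝ]
      congr 1 with y
      rw [← Finset.sum_mul, sum_poissonKerDeriv₂_eq_zero (by simp) (ne_coe_unitSphere hx y),
        zero_mul]
    · intro i _
      have hc : Continuous fun y : UnitSphere d =>
          poissonKerDeriv₂ s (EuclideanSpace.single i 1) x y * φ y := by
        refine Continuous.mul ?_ hφ
        rw [← continuousOn_univ]
        exact (continuousOn_poissonKerDeriv₂ s _).comp
          (f := fun y : UnitSphere d => (x, (y : EucSpace d)))
          (by fun_prop) fun y _ => ne_coe_unitSphere hx y
      exact hc.integrable_of_hasCompactSupport (HasCompactSupport.of_compactSpace _)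

/-! ### Surface area, rotation invariance and the mass of the kernel -/

/-- The total mass is `d` times the volume of the unit ball; `Γ(d/2 + 1) = (d/2) Γ(d/2)` brings it
to the stated form. -/
theorem surfaceMeasure_real_univ {d : ℕ} (hd : 0 < d) :
    (surfaceMeasure d).real univ = sphereArea d := by
  have : Nonempty (Fin d) := ⟨⟨0, hd⟩⟩
  have hd' : (0 : ℝ) < d := by exact_mod_cast hd
  have hG : Real.Gamma ((d : ℝ) / 2 + 1) = (d : ℝ) / 2 * Real.Gamma ((d : ℝ) / 2) :=
    Real.Gamma_add_one (by positivity)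
  have hG0 := Real.Gamma_pos_of_pos (show 0 < (d : ℝ) / 2 by positivity)
  have hpi : √Real.pi ^ d = Real.pi ^ ((d : ℝ) / 2) := by
    rw [Real.sqrt_eq_rpow, ← Real.rpow_mul_natCast Real.pi_pos.le]
    congr 1
    ring
  rw [surfaceMeasure, Measure.toSphere_real_apply_univ, measureReal_def,
    EuclideanSpace.volume_ball]
  simp only [ENNReal.ofReal_one, one_pow, one_mul, Fintype.card_fin, finrank_euclideanSpace]
  rw [ENNReal.toReal_ofReal (by rw [hG]; positivity), hG, hpi, sphereArea]
  field_simp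

theorem sphereArea_pos {d : ℕ} (hd : 0 < d) : 0 < sphereArea d := by
  have hd' : (0 : ℝ) < d := by exact_mod_cast hd
  have hG0 := Real.Gamma_pos_of_pos (show 0 < (d : ℝ) / 2 by positivity)
  have := Real.pi_pos
  unfold sphereArea
  positivity

/-- The restriction of a linear isometry to the unit sphere. -/
noncomputable def sphereMap {d : ℕ} (T : EucSpace d ≃ₗᵢ[ℝ] EucSpace d) (y : UnitSphere d) : UnitSphere d :=
  ⟨T y, by simp⟩

theorem continuous_sphereMap {d : ℕ} (T : EucSpace d ≃ₗᵢ[ℝ] EucSpace d) :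
    Continuous (sphereMap T) :=
  (T.continuous.comp continuous_subtype_val).subtype_mk _

open scoped Pointwise in
-- The surface measure of a set is `d` times the volume of the cone over it; `T` commutes with
-- forming cones and preserves volume.
theorem measurePreserving_sphereMap {d : ℕ} (T : EucSpace d ≃ₗᵢ[ℝ] EucSpace d) :
    MeasurePreserving (sphereMap T) (surfaceMeasure d) (surfaceMeasure d) := by
  have hm := (continuous_sphereMap T).measurable
  refine ⟨hm, Measure.ext fun s hs => ?_⟩
  rw [Measure.map_apply hm hs, surfaceMeasure, Measure.toSphere_apply' _ hs,
    Measure.toSphere_apply' _ (hm hs)]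
  congr 1
  have hset : Ioo (0 : ℝ) 1 • ((↑) '' (sphereMap T ⁻¹' s) : Set (EucSpace d)) =
      T ⁻¹' (Ioo (0 : ℝ) 1 • ((↑) '' s)) := by
    ext x
    simp only [Set.mem_smul, mem_image, mem_preimage]
    constructor
    · rintro ⟨r, hr, -, ⟨y, hy, rfl⟩, rfl⟩
      exact ⟨r, hr, _, ⟨_, hy, rfl⟩, by simp [sphereMap]⟩
    · rintro ⟨r, hr, -, ⟨y, hy, rfl⟩, hxy⟩
      refine ⟨r, hr, _, ⟨sphereMap T.symm y, ?_, rfl⟩, T.injective ?_⟩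
      · simpa [sphereMap] using hy
      · simp [sphereMap, hxy]
  rw [hset]
  exact T.measurePreserving.measure_preimage_equiv (f := T.toHomeomorph.toMeasurableEquiv) _

theorem poissonInt_one_comp {d : ℕ} (T : EucSpace d ≃ₗᵢ[ℝ] EucSpace d) {x : EucSpace d}
    (hx : ‖x‖ < 1) : poissonInt (fun _ => 1) (T x) = poissonInt (fun _ => 1) x := by
  have hT := measurePreserving_sphereMap T
  have hc : Continuous fun y : UnitSphere d => poissonKer ((d : ℝ) / 2) (T x) y :=
    continuous_poissonKer _ (by simpa using hx)
  simp only [poissonInt, mul_one]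
  rw [← hT.map_eq, integral_map hT.aemeasurable hc.aestronglyMeasurable, hT.map_eq]
  congr 1 with y
  have : ‖T x - T y‖ = ‖x - y‖ := by rw [← map_sub, T.norm_map]
  simp only [poissonKer, sphereMap, this, T.norm_map]

/-- The integral is harmonic and, by rotation invariance, constant on the sphere through `x`. The
maximum principle for it and its negative extends this constant to the centre, where the kernel is
`1`. -/
theorem poissonInt_one {d : ℕ} (hd : 0 < d) {x : EucSpace d} (hx : ‖x‖ < 1) :
    poissonInt (fun _ => 1) x = sphereArea d := by
  set H : EucSpace d → ℝ := poissonInt fun _ => 1 with hH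
  have h0 : H 0 = sphereArea d := by
    rw [← surfaceMeasure_real_univ hd]
    simp [hH, poissonInt, poissonKer]
  rw [← h0]
  have hrot : ∀ z ∈ sphere (0 : EucSpace d) ‖x‖, H z = H x := fun z hz => by
    have hz' : ‖z‖ = ‖x‖ := by simpa using hz
    -- The reflection in the hyperplane orthogonal to `x - z` carries `x` to `z`, as their norms
    -- agree.
    rw [← Submodule.reflection_sub (v := x) (w := z) hz'.symm]
    exact poissonInt_one_comp _ hx
  have hcont : ContinuousOn H (closedBall 0 ‖x‖) := continuousOn_poissonInt continuous_const hx
  have hharm : ∀ z ∈ ball (0 : EucSpace d) ‖x‖, HasZeroLaplacianAt H z := fun z hz =>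
    hasZeroLaplacianAt_poissonInt continuous_const ((mem_ball_zero_iff.1 hz).trans hx)
  have hmem : (0 : EucSpace d) ∈ closedBall (0 : EucSpace d) ‖x‖ := by simp
  have h1 := le_of_hasZeroLaplacianAt_of_le_sphere hd hcont hharm (fun z hz => (hrot z hz).le) hmem
  have h2 := le_of_hasZeroLaplacianAt_of_le_sphere hd (u := fun z => -1 * H z) (M := -H x)
    (continuousOn_const.mul hcont) (fun z hz => (hharm z hz).const_mul (-1))
    (fun z hz => by rw [hrot z hz]; linarith) hmem
  linarith

/-! ### Boundary values and Poisson's formula -/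

/-- The Poisson integral converges to its boundary values, uniformly on the sphere. -/
theorem eventually_abs_poissonInt_sub_le {d : ℕ} (hd : 0 < d) {φ : UnitSphere d → ℝ}
    (hφ : Continuous φ) {ε : ℝ} (hε : 0 < ε) :
    ∀ᶠ r in 𝓝[<] (1 : ℝ), ∀ ζ : UnitSphere d,
      |poissonInt φ (r • (ζ : EucSpace d)) - sphereArea d * φ ζ| ≤ ε := by
  set A := sphereArea d with hA
  set s : ℝ := (d : ℝ) / 2 with hs
  have hApos : 0 < A := sphereArea_pos hd
  have hs0 : 0 ≤ s := by positivity
  obtain ⟨δ, hδ, hunif⟩ := Metric.uniformContinuous_iff.1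
    (CompactSpace.uniformContinuous_of_continuous hφ) (ε / (2 * A)) (by positivity)
  obtain ⟨C, hC⟩ : ∃ C, ∀ y, |φ y| ≤ C := by
    obtain ⟨C, hC⟩ := (isCompact_univ (X := UnitSphere d)).exists_bound_of_continuousOn
      hφ.continuousOn
    exact ⟨C, fun y => hC y (mem_univ _)⟩
  -- `B` bounds `|x - y|^(-d)` for `y` at distance at least `δ` from `ζ`, once `x = rζ` with `1 - r
  -- < δ/2`.
  set B : ℝ := ((δ / 2) ^ 2) ^ (-s) with hB
  have hlim : Tendsto (fun r : ℝ => (1 - r ^ 2) * B * (2 * C) * A) (𝓝[<] 1) (𝓝 0) := by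
    have : Continuous fun r : ℝ => (1 - r ^ 2) * B * (2 * C) * A := by fun_prop
    simpa using (this.tendsto 1).mono_left nhdsWithin_le_nhds
  filter_upwards [hlim.eventually_le_const (show 0 < ε / 2 by positivity),
    Ioo_mem_nhdsLT (show max 0 (1 - δ / 2) < 1 by rw [max_lt_iff]; constructor <;> linarith)]
    with r hr1 hr2 ζ
  obtain ⟨hr0, hrδ⟩ := max_lt_iff.1 hr2.1
  have hζ : ‖(ζ : EucSpace d)‖ = 1 := by simp
  have hnorm : ‖r • (ζ : EucSpace d)‖ = r := by
    rw [norm_smul, hζ, mul_one, Real.norm_of_nonneg hr0.le]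
  have hlt : ‖r • (ζ : EucSpace d)‖ < 1 := hnorm.trans_lt hr2.2
  set x := r • (ζ : EucSpace d) with hx
  have hint : ∀ {h : UnitSphere d → ℝ}, Continuous h → Integrable h (surfaceMeasure d) :=
    fun hh => hh.integrable_of_hasCompactSupport (HasCompactSupport.of_compactSpace _)
  have hK := continuous_poissonKer s hlt
  have hK1 : ∫ y : UnitSphere d, poissonKer s x y ∂(surfaceMeasure d) = A := by
    simpa [poissonInt] using poissonInt_one hd hlt
  have hKc : ∀ c : ℝ, Integrable (fun y : UnitSphere d => poissonKer s x y * c)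
      (surfaceMeasure d) := fun c => hint (hK.mul continuous_const)
  have hKφ : Integrable (fun y : UnitSphere d => poissonKer s x y * φ y) (surfaceMeasure d) :=
    hint (hK.mul hφ)
  have hdiff : poissonInt φ x - A * φ ζ =
      ∫ y : UnitSphere d, poissonKer s x y * (φ y - φ ζ) ∂(surfaceMeasure d) := by
    simp_rw [mul_sub]
    rw [integral_sub hKφ (hKc _), integral_mul_const, hK1]
    rfl
  -- Near `ζ` the oscillation of `φ` is small; far from `ζ` the kernel is small. The sum of the two
  -- bounds serves both cases; its first term integrates to `ε/2`, its second to at most `ε/2` by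
  -- the choice of `r`.
  have hpt : ∀ y : UnitSphere d, ‖poissonKer s x y * (φ y - φ ζ)‖ ≤
      poissonKer s x y * (ε / (2 * A)) + (1 - r ^ 2) * B * (2 * C) := fun y => by
    have hk0 := poissonKer_nonneg (s := s) hlt.le (y : EucSpace d)
    have hC0 : 0 ≤ C := (abs_nonneg _).trans (hC ζ)
    have hB0 : 0 ≤ B := by positivity
    have hr2' : 0 ≤ 1 - r ^ 2 := by nlinarith [hr2.2]
    rw [norm_mul, Real.norm_of_nonneg hk0, Real.norm_eq_abs]
    by_cases hy : dist y ζ < δ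
    · have h1 : |φ y - φ ζ| ≤ ε / (2 * A) := (hunif hy).le
      have h2 : 0 ≤ (1 - r ^ 2) * B * (2 * C) := by positivity
      have h3 := mul_le_mul_of_nonneg_left h1 hk0
      linarith
    · have hdist : δ / 2 ≤ ‖x - y‖ := by
        have h1 : dist y ζ = ‖(y : EucSpace d) - ζ‖ := by rw [Subtype.dist_eq, dist_eq_norm]
        have h2 : ‖(y : EucSpace d) - ζ‖ ≤ ‖x - y‖ + ‖x - ζ‖ := by
          rw [norm_sub_rev x y]
          exact norm_sub_le_norm_sub_add_norm_sub _ _ _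
        have h3 : ‖x - ζ‖ = 1 - r := by
          have : x - ζ = (r - 1) • (ζ : EucSpace d) := by rw [hx, sub_smul, one_smul]
          rw [this, norm_smul, hζ, mul_one, Real.norm_eq_abs, abs_sub_comm,
            abs_of_pos (by linarith [hr2.2])]
        rw [h1] at hy
        linarith
      have h1 : poissonKer s x y ≤ (1 - r ^ 2) * B := by
        rw [poissonKer, hnorm]
        refine mul_le_mul_of_nonneg_left ?_ hr2'
        exact Real.rpow_le_rpow_of_nonpos (by positivity) (by gcongr) (by linarith)
      have h2 : |φ y - φ ζ| ≤ 2 * C := by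
        linarith [abs_sub (φ y) (φ ζ), hC y, hC ζ]
      have h3 : 0 ≤ poissonKer s x y * (ε / (2 * A)) := by positivity
      have h4 : poissonKer s x y * |φ y - φ ζ| ≤ (1 - r ^ 2) * B * (2 * C) :=
        mul_le_mul h1 h2 (abs_nonneg _) (by positivity)
      linarith
  rw [hdiff, ← Real.norm_eq_abs]
  refine (norm_integral_le_of_norm_le ((hKc _).add (integrable_const _)) (.of_forall hpt)).trans ?_
  rw [integral_add' (hKc _) (integrable_const _), integral_mul_const, hK1,
    integral_const, surfaceMeasure_real_univ hd, smul_eq_mul]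
  have : A * (ε / (2 * A)) = ε / 2 := by field_simp
  rw [this]
  linarith [mul_comm A ((1 - r ^ 2) * B * (2 * C))]

/-- **Poisson's formula** on the unit ball. -/
theorem poissonInt_eq_of_harmonic {d : ℕ} (hd : 0 < d) {f : EucSpace d → ℝ}
    (hf_C2 : ContDiffOn ℝ 2 f (ball 0 1)) (hf_cont : ContinuousOn f (closedBall 0 1))
    (hf_harm : ∀ x ∈ ball (0 : EucSpace d) 1, Laplacian.laplacian f x = 0)
    {x : EucSpace d} (hx : ‖x‖ < 1) :
    poissonInt (fun y : UnitSphere d => f y) x = sphereArea d * f x := by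
  set A := sphereArea d with hA
  have hApos : 0 < A := sphereArea_pos hd
  have hφ : Continuous fun y : UnitSphere d => f y :=
    hf_cont.comp_continuous continuous_subtype_val fun y => sphere_subset_closedBall y.2
  set F := poissonInt fun y : UnitSphere d => f y with hF
  rw [← sub_eq_zero, ← abs_nonpos_iff]
  refine le_of_forall_pos_le_add fun ε hε => ?_
  rw [zero_add]
  -- The comparison takes place on a ball of radius `r < 1`, since the Poisson integral is
  -- controlled only inside the open unit ball. On its boundary, `F(rζ)` is close to `A f(ζ)`, which
  -- is close to `A f(rζ)` by uniform continuity.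
  obtain ⟨δ, hδ, hunif⟩ := Metric.uniformContinuousOn_iff.1
    ((isCompact_closedBall (0 : EucSpace d) 1).uniformContinuousOn_of_continuous hf_cont)
    (ε / (2 * A)) (by positivity)
  have hev := (eventually_abs_poissonInt_sub_le hd hφ (show 0 < ε / 2 by positivity)).and
    (Ioo_mem_nhdsLT (show max ‖x‖ (1 - δ) < 1 from max_lt hx (by linarith)))
  obtain ⟨r, hr1, hr2⟩ := hev.exists
  obtain ⟨hrx, hrδ⟩ := max_lt_iff.1 hr2.1
  have hr0 : 0 < r := (norm_nonneg x).trans_lt hrx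
  have hsub : closedBall (0 : EucSpace d) r ⊆ closedBall 0 1 :=
    closedBall_subset_closedBall hr2.2.le
  have hbound : ∀ z ∈ sphere (0 : EucSpace d) r, |F z - A * f z| ≤ ε := fun z hz => by
    have hz' : ‖z‖ = r := by simpa using hz
    set ζ : UnitSphere d := ⟨r⁻¹ • z, by
      rw [mem_sphere_zero_iff_norm, norm_smul, hz', norm_inv, Real.norm_of_nonneg hr0.le,
        inv_mul_cancel₀ hr0.ne']⟩ with hζ
    have hzζ : z = r • (ζ : EucSpace d) := by
      rw [hζ, smul_smul, mul_inv_cancel₀ hr0.ne', one_smul]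
    have hζ1 : ‖(ζ : EucSpace d)‖ = 1 := by simp
    have h1 := hr1 ζ
    rw [← hzζ] at h1
    have hd1 : dist (ζ : EucSpace d) z < δ := by
      have : (ζ : EucSpace d) - z = (1 - r) • (ζ : EucSpace d) := by
        rw [sub_smul, one_smul, ← hzζ]
      rw [dist_eq_norm, this, norm_smul, hζ1, mul_one, Real.norm_of_nonneg (by linarith [hr2.2])]
      linarith
    have h2 := hunif ζ (sphere_subset_closedBall ζ.2) z (hsub (sphere_subset_closedBall hz)) hd1
    rw [Real.dist_eq] at h2
    have h3 : |A * f ζ - A * f z| ≤ ε / 2 := by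
      rw [← mul_sub, abs_mul, abs_of_pos hApos]
      calc A * |f ζ - f z| ≤ A * (ε / (2 * A)) := by gcongr
        _ = ε / 2 := by field_simp
    linarith [abs_sub_le (F z) (A * f ζ) (A * f z)]
  have hFc : ContinuousOn F (closedBall 0 r) := continuousOn_poissonInt hφ hr2.2
  have hfc : ContinuousOn f (closedBall 0 r) := hf_cont.mono hsub
  have hFh : ∀ z ∈ ball (0 : EucSpace d) r, HasZeroLaplacianAt F z := fun z hz =>
    hasZeroLaplacianAt_poissonInt hφ ((mem_ball_zero_iff.1 hz).trans hr2.2)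
  have hfh : ∀ z ∈ ball (0 : EucSpace d) r, HasZeroLaplacianAt f z := fun z hz => by
    have hz1 : z ∈ ball (0 : EucSpace d) 1 := ball_subset_ball hr2.2.le hz
    exact .of_laplacian_eq_zero (hf_C2.contDiffAt (isOpen_ball.mem_nhds hz1)) (hf_harm z hz1)
  have hxr : x ∈ closedBall (0 : EucSpace d) r := by simpa using hrx.le
  -- The maximum principle applied to `F - A f` and to its negative carries the bound `ε` from the
  -- sphere of radius `r` to `x`.
  have hupper := le_of_hasZeroLaplacianAt_of_le_sphere hd (M := ε)
    (u := fun z => F z + -A * f z)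
    (hFc.add (continuousOn_const.mul hfc)) (fun z hz => (hFh z hz).add ((hfh z hz).const_mul _))
    (fun z hz => by linarith [(abs_le.1 (hbound z hz)).2]) hxr
  have hlower := le_of_hasZeroLaplacianAt_of_le_sphere hd (M := ε)
    (u := fun z => -1 * F z + A * f z)
    ((continuousOn_const.mul hFc).add (continuousOn_const.mul hfc))
    (fun z hz => ((hFh z hz).const_mul _).add ((hfh z hz).const_mul _))
    (fun z hz => by linarith [(abs_le.1 (hbound z hz)).1]) hxr
  exact abs_le.2 ⟨by linarith, by linarith⟩

/-! ### Orthogonal matrices and the density as a Poisson kernel -/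

theorem continuous_matMul {d : ℕ} (M : Matrix (Fin d) (Fin d) ℝ) : Continuous (matMul M) := by
  unfold matMul
  fun_prop

theorem inner_matMul_right {d : ℕ} (M : Matrix (Fin d) (Fin d) ℝ) (x y : EucSpace d) :
    inner ℝ x (matMul M y) = inner ℝ (matMul M.transpose x) y := by
  simp only [matMul, EuclideanSpace.inner_eq_star_dotProduct, star_trivial]
  rw [dotProduct_comm, Matrix.dotProduct_mulVec, Matrix.mulVec_transpose, dotProduct_comm]

theorem norm_matMul {d : ℕ} {Q : Matrix (Fin d) (Fin d) ℝ}
    (hQ : Q ∈ Matrix.orthogonalGroup (Fin d) ℝ) (x : EucSpace d) : ‖matMul Q x‖ = ‖x‖ := by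
  have h1 : matMul Q.transpose (matMul Q x) = x := by
    have : Q.transpose * Q = 1 := (Matrix.mem_orthogonalGroup_iff' _ _).1 hQ
    simp [matMul, this]
  have h2 : ‖matMul Q x‖ ^ 2 = ‖x‖ ^ 2 := by
    rw [← real_inner_self_eq_norm_sq, inner_matMul_right, h1, real_inner_self_eq_norm_sq]
  exact (pow_left_inj₀ (norm_nonneg _) (norm_nonneg _) two_ne_zero).1 h2

theorem transpose_mem_orthogonalGroup {d : ℕ} {Q : Matrix (Fin d) (Fin d) ℝ}
    (hQ : Q ∈ Matrix.orthogonalGroup (Fin d) ℝ) :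
    Q.transpose ∈ Matrix.orthogonalGroup (Fin d) ℝ := by
  rw [Matrix.mem_orthogonalGroup_iff, Matrix.transpose_transpose]
  exact (Matrix.mem_orthogonalGroup_iff' _ _).1 hQ

/-- This symmetry lets every statement about `V` given `U` yield the one about `U` given `V`. -/
theorem bsDensity_transpose {d : ℕ} (ρ : ℝ) (Q : Matrix (Fin d) (Fin d) ℝ) (u v : UnitSphere d) :
    bsDensity ρ Q.transpose v u = bsDensity ρ Q u v := by
  simp only [bsDensity, inner_matMul_right, Matrix.transpose_transpose]
  rw [real_inner_comm, inner_matMul_right]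

theorem norm_smul_matMul_transpose_lt_one {d : ℕ} {ρ : ℝ} (hρ0 : 0 ≤ ρ) (hρ1 : ρ < 1)
    {Q : Matrix (Fin d) (Fin d) ℝ} (hQ : Q ∈ Matrix.orthogonalGroup (Fin d) ℝ)
    (u : UnitSphere d) : ‖ρ • matMul Q.transpose (u : EucSpace d)‖ < 1 := by
  rw [norm_smul, norm_matMul (transpose_mem_orthogonalGroup hQ)]
  simpa [abs_of_nonneg hρ0] using hρ1

theorem bsDensity_eq_poissonKer {d : ℕ} (ρ : ℝ) {Q : Matrix (Fin d) (Fin d) ℝ}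
    (hQ : Q ∈ Matrix.orthogonalGroup (Fin d) ℝ) (u v : UnitSphere d) :
    bsDensity ρ Q u v =
      1 / sphereArea d ^ 2 * poissonKer ((d : ℝ) / 2) (ρ • matMul Q.transpose u) v := by
  have hn : ‖ρ • matMul Q.transpose (u : EucSpace d)‖ ^ 2 = ρ ^ 2 := by
    rw [norm_smul, norm_matMul (transpose_mem_orthogonalGroup hQ)]
    simp
  have hq : ‖ρ • matMul Q.transpose (u : EucSpace d) - v‖ ^ 2 =
      1 - 2 * ρ * inner ℝ (u : EucSpace d) (matMul Q v) + ρ ^ 2 := by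
    rw [norm_sub_sq_real, hn, inner_smul_left, inner_matMul_right]
    simp
    ring
  rw [bsDensity, poissonKer, ← hq, hn, Real.rpow_neg (by positivity), div_eq_mul_inv (1 - ρ ^ 2)]

section

variable {d : ℕ} {ρ : ℝ} {Q : Matrix (Fin d) (Fin d) ℝ}

theorem bsDensity_nonneg (hρ0 : 0 ≤ ρ) (hρ1 : ρ < 1)
    (hQ : Q ∈ Matrix.orthogonalGroup (Fin d) ℝ) (u v : UnitSphere d) :
    0 ≤ bsDensity ρ Q u v := by
  rw [bsDensity_eq_poissonKer ρ hQ]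
  exact mul_nonneg (by positivity)
    (poissonKer_nonneg (norm_smul_matMul_transpose_lt_one hρ0 hρ1 hQ u).le _)

theorem continuous_bsDensity (hρ0 : 0 ≤ ρ) (hρ1 : ρ < 1)
    (hQ : Q ∈ Matrix.orthogonalGroup (Fin d) ℝ) :
    Continuous fun p : UnitSphere d × UnitSphere d => bsDensity ρ Q p.1 p.2 := by
  simp_rw [bsDensity_eq_poissonKer ρ hQ]
  refine continuous_const.mul ?_
  have := continuous_matMul Q.transpose
  rw [← continuousOn_univ]
  exact (continuousOn_poissonKer ((d : ℝ) / 2)).comp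
    (f := fun p : UnitSphere d × UnitSphere d =>
      (ρ • matMul Q.transpose (p.1 : EucSpace d), (p.2 : EucSpace d)))
    (by fun_prop) fun p _ => ne_coe_unitSphere
      (norm_smul_matMul_transpose_lt_one hρ0 hρ1 hQ p.1) p.2

theorem integral_bsDensity_mul (hQ : Q ∈ Matrix.orthogonalGroup (Fin d) ℝ)
    (φ : UnitSphere d → ℝ) (u : UnitSphere d) :
    ∫ v, bsDensity ρ Q u v * φ v ∂(surfaceMeasure d) =
      1 / sphereArea d ^ 2 * poissonInt φ (ρ • matMul Q.transpose u) := by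
  simp_rw [bsDensity_eq_poissonKer ρ hQ, mul_assoc]
  rw [integral_const_mul, poissonInt]

/-- The constant mass `A` of the Poisson kernel makes the marginal uniform, so conditioning merely
multiplies the joint density by `A`. -/
theorem integral_bsDensity (hd : 0 < d) (hρ0 : 0 ≤ ρ) (hρ1 : ρ < 1)
    (hQ : Q ∈ Matrix.orthogonalGroup (Fin d) ℝ) (u : UnitSphere d) :
    ∫ v, bsDensity ρ Q u v ∂(surfaceMeasure d) = 1 / sphereArea d := by
  have h := integral_bsDensity_mul (ρ := ρ) hQ (fun _ => 1) u
  rw [poissonInt_one hd (norm_smul_matMul_transpose_lt_one hρ0 hρ1 hQ u)] at h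
  have := (sphereArea_pos hd).ne'
  simp only [mul_one] at h
  rw [h]
  field_simp

theorem integral_bsDensity_mul_harmonic (hd : 0 < d) (hρ0 : 0 ≤ ρ) (hρ1 : ρ < 1)
    (hQ : Q ∈ Matrix.orthogonalGroup (Fin d) ℝ) {f : EucSpace d → ℝ}
    (hf_C2 : ContDiffOn ℝ 2 f (ball 0 1)) (hf_cont : ContinuousOn f (closedBall 0 1))
    (hf_harm : ∀ x ∈ ball (0 : EucSpace d) 1, Laplacian.laplacian f x = 0) (u : UnitSphere d) :
    ∫ v : UnitSphere d, bsDensity ρ Q u v * f v ∂(surfaceMeasure d) =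
      1 / sphereArea d * f (ρ • matMul Q.transpose u) := by
  rw [integral_bsDensity_mul hQ (fun v => f v), poissonInt_eq_of_harmonic hd hf_C2 hf_cont hf_harm
    (norm_smul_matMul_transpose_lt_one hρ0 hρ1 hQ u)]
  have := (sphereArea_pos hd).ne'
  field_simp

theorem condMean_bsDensity_of_harmonic (hd : 0 < d) (hρ0 : 0 ≤ ρ) (hρ1 : ρ < 1)
    (hQ : Q ∈ Matrix.orthogonalGroup (Fin d) ℝ) {f : EucSpace d → ℝ}
    (hf_C2 : ContDiffOn ℝ 2 f (ball 0 1)) (hf_cont : ContinuousOn f (closedBall 0 1))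
    (hf_harm : ∀ x ∈ ball (0 : EucSpace d) 1, Laplacian.laplacian f x = 0) (u : UnitSphere d) :
    condMean (bsDensity ρ Q) (fun v => f v) u = f (ρ • matMul Q.transpose u) := by
  have hA := (sphereArea_pos hd).ne'
  have h : ∀ v : UnitSphere d, f v * condDensity (bsDensity ρ Q) u v =
      sphereArea d * (bsDensity ρ Q u v * f v) := fun v => by
    rw [condDensity, integral_bsDensity hd hρ0 hρ1 hQ]
    field_simp
  simp_rw [condMean, h]
  rw [integral_const_mul, integral_bsDensity_mul_harmonic hd hρ0 hρ1 hQ hf_C2 hf_cont hf_harm]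
  field_simp

/-! ### Random vectors and conditional expectations -/

variable {Ω : Type*} [MeasurableSpace Ω] {P : Measure Ω} {U V : Ω → UnitSphere d}

theorem HasBSLaw.symm (h : HasBSLaw P U V ρ Q) : HasBSLaw P V U ρ Q.transpose where
  measurable_fst := h.measurable_snd
  measurable_snd := h.measurable_fst
  law := by
    have h1 : P.map (fun ω => (V ω, U ω)) = (P.map fun ω => (U ω, V ω)).map Prod.swap := by
      rw [Measure.map_map measurable_swap (h.measurable_fst.prodMk h.measurable_snd)]
      rfl
    have hemb : MeasurableEmbedding (Prod.swap : UnitSphere d × UnitSphere d → _) :=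
      MeasurableEquiv.prodComm.measurableEmbedding
    rw [h1, h.law]
    ext s hs
    rw [Measure.map_apply measurable_swap hs, withDensity_apply _ (measurable_swap hs),
      withDensity_apply _ hs,
      ← Measure.measurePreserving_swap.setLIntegral_comp_preimage_emb hemb]
    simp only [Prod.fst_swap, Prod.snd_swap, bsDensity_transpose, ← preimage_comp,
      Prod.swap_swap_eq, preimage_id]

/-- Every event of `σ(U)` has the form `U ⁻¹' B`, so this computes all integrals that test a
conditional expectation given `U`. Fubini applies because the integrand is continuous on a compact
space. -/
theorem HasBSLaw.setIntegral_preimage_fst (h : HasBSLaw P U V ρ Q) (hρ0 : 0 ≤ ρ) (hρ1 : ρ < 1)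
    (hQ : Q ∈ Matrix.orthogonalGroup (Fin d) ℝ) {k : UnitSphere d × UnitSphere d → ℝ}
    (hk : Continuous k) {B : Set (UnitSphere d)} (hB : MeasurableSet B) :
    ∫ ω in U ⁻¹' B, k (U ω, V ω) ∂P =
      ∫ u in B, ∫ v, bsDensity ρ Q u v * k (u, v) ∂(surfaceMeasure d) ∂(surfaceMeasure d) := by
  have hc := continuous_bsDensity hρ0 hρ1 hQ
  have hint : Integrable (fun p : UnitSphere d × UnitSphere d => bsDensity ρ Q p.1 p.2 * k p)
      ((surfaceMeasure d).prod (surfaceMeasure d)) :=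
    (hc.mul hk).integrable_of_hasCompactSupport (HasCompactSupport.of_compactSpace _)
  have hpre : U ⁻¹' B = (fun ω => (U ω, V ω)) ⁻¹' (B ×ˢ univ) := by
    ext
    simp
  rw [hpre, ← setIntegral_map (f := k) (hB.prod .univ) hk.aestronglyMeasurable
    (h.measurable_fst.prodMk h.measurable_snd).aemeasurable, h.law,
    setIntegral_withDensity_eq_setIntegral_toReal_smul hc.measurable.ennreal_ofReal
      (.of_forall fun _ => ENNReal.ofReal_lt_top) _ (hB.prod .univ)]
  simp_rw [ENNReal.toReal_ofReal (bsDensity_nonneg hρ0 hρ1 hQ _ _), smul_eq_mul]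
  rw [setIntegral_prod _ hint.integrableOn]
  simp

theorem integrable_comp_of_continuous [IsProbabilityMeasure P] (hV : Measurable V)
    {φ : UnitSphere d → ℝ} (hφ : Continuous φ) : Integrable (fun ω => φ (V ω)) P := by
  obtain ⟨C, hC⟩ := (isCompact_univ (X := UnitSphere d)).exists_bound_of_continuousOn
    hφ.continuousOn
  exact .of_bound (hφ.measurable.comp hV).aestronglyMeasurable C
    (.of_forall fun ω => hC _ (mem_univ _))

/-- On `U ⁻¹' B` both sides integrate to `A⁻¹ ∫_B f(ρQ'u) dσ(u)`: one by the uniform marginal, the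
other by Poisson's formula. -/
theorem HasBSLaw.condExp_comp_snd_of_harmonic [IsProbabilityMeasure P] (h : HasBSLaw P U V ρ Q)
    (hd : 0 < d) (hρ0 : 0 ≤ ρ) (hρ1 : ρ < 1) (hQ : Q ∈ Matrix.orthogonalGroup (Fin d) ℝ)
    {f : EucSpace d → ℝ}
    (hf_C2 : ContDiffOn ℝ 2 f (ball 0 1)) (hf_cont : ContinuousOn f (closedBall 0 1))
    (hf_harm : ∀ x ∈ ball (0 : EucSpace d) 1, Laplacian.laplacian f x = 0) :
    P[fun ω => f (V ω) | MeasurableSpace.comap U inferInstance]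
      =ᵐ[P] fun ω => f (ρ • matMul Q.transpose (U ω)) := by
  have hφ : Continuous fun y : UnitSphere d => f y :=
    hf_cont.comp_continuous continuous_subtype_val fun y => sphere_subset_closedBall y.2
  have hM := continuous_matMul Q.transpose
  have hψ : Continuous fun y : UnitSphere d => f (ρ • matMul Q.transpose (y : EucSpace d)) :=
    hf_cont.comp_continuous (by fun_prop) fun y =>
      mem_closedBall_zero_iff.2 (norm_smul_matMul_transpose_lt_one hρ0 hρ1 hQ y).le
  refine (ae_eq_condExp_of_forall_setIntegral_eq h.measurable_fst.comap_le
    (integrable_comp_of_continuous h.measurable_snd hφ)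
    (fun s _ _ => (integrable_comp_of_continuous h.measurable_fst hψ).integrableOn) ?_ ?_).symm
  · rintro - ⟨B, hB, rfl⟩ -
    have h1 := h.setIntegral_preimage_fst hρ0 hρ1 hQ (hψ.comp continuous_fst) hB
    have h2 := h.setIntegral_preimage_fst hρ0 hρ1 hQ (hφ.comp continuous_snd) hB
    simp only [Function.comp_apply] at h1 h2
    rw [h1, h2]
    congr 1 with u
    rw [integral_mul_const, integral_bsDensity hd hρ0 hρ1 hQ,
      integral_bsDensity_mul_harmonic hd hρ0 hρ1 hQ hf_C2 hf_cont hf_harm]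
  · exact (hψ.measurable.comp (comap_measurable U)).aestronglyMeasurable

/-- As `U` is uniform, this is the mean value property, that is, Poisson's formula at the centre. -/
theorem HasBSLaw.integral_comp_fst_of_harmonic (h : HasBSLaw P U V ρ Q)
    (hd : 0 < d) (hρ0 : 0 ≤ ρ) (hρ1 : ρ < 1) (hQ : Q ∈ Matrix.orthogonalGroup (Fin d) ℝ)
    {f : EucSpace d → ℝ}
    (hf_C2 : ContDiffOn ℝ 2 f (ball 0 1)) (hf_cont : ContinuousOn f (closedBall 0 1))
    (hf_harm : ∀ x ∈ ball (0 : EucSpace d) 1, Laplacian.laplacian f x = 0) :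
    ∫ ω, f (U ω) ∂P = f 0 := by
  have hφ : Continuous fun y : UnitSphere d => f y :=
    hf_cont.comp_continuous continuous_subtype_val fun y => sphere_subset_closedBall y.2
  have hA := (sphereArea_pos hd).ne'
  have h0 : ∫ y : UnitSphere d, f y ∂(surfaceMeasure d) = sphereArea d * f 0 := by
    rw [← poissonInt_eq_of_harmonic hd hf_C2 hf_cont hf_harm (by simp)]
    simp [poissonInt, poissonKer]
  have h1 := h.setIntegral_preimage_fst hρ0 hρ1 hQ (hφ.comp continuous_fst) MeasurableSet.univ
  simp only [preimage_univ, Measure.restrict_univ, Function.comp_apply, integral_mul_const,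
    integral_bsDensity hd hρ0 hρ1 hQ, integral_const_mul, h0] at h1
  rw [h1]
  field_simp

end

theorem theorem1 {Ω : Type*} [MeasurableSpace Ω] (P : Measure Ω) [IsProbabilityMeasure P]
    (d : ℕ) (hd : 2 ≤ d)
    (ρ : ℝ) (hρ0 : 0 ≤ ρ) (hρ1 : ρ < 1)
    (Q : Matrix (Fin d) (Fin d) ℝ) (hQ : Q ∈ Matrix.orthogonalGroup (Fin d) ℝ)
    (U V : Ω → UnitSphere d) (hUV : HasBSLaw P U V ρ Q)
    (f : EucSpace d → ℝ)
    (hf_C2 : ContDiffOn ℝ 2 f (ball 0 1))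
    (hf_cont : ContinuousOn f (closedBall 0 1))
    (hf_harm : ∀ x ∈ ball (0 : EucSpace d) 1, Laplacian.laplacian f x = 0) :
    -- `E{f(V) | U = u} = f(ρ Q' u)`: for every `u` through the conditional density of `V` given
    -- `U = u`, and as a conditional expectation given the σ-algebra generated by `U`
    (∀ u : UnitSphere d,
      condMean (bsDensity ρ Q) (fun v => f v) u = f (ρ • matMul Q.transpose u)) ∧
    Integrable (fun ω => f (V ω)) P ∧
    (P[fun ω => f (V ω) | MeasurableSpace.comap U inferInstance]
      =ᵐ[P] fun ω => f (ρ • matMul Q.transpose (U ω))) ∧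
    -- `E{f(U) | V = v} = f(ρ Q v)`, in the same two forms
    (∀ v : UnitSphere d,
      condMean (fun y x => bsDensity ρ Q x y) (fun u => f u) v = f (ρ • matMul Q v)) ∧
    Integrable (fun ω => f (U ω)) P ∧
    (P[fun ω => f (U ω) | MeasurableSpace.comap V inferInstance]
      =ᵐ[P] fun ω => f (ρ • matMul Q (V ω))) ∧
    -- `E f(U) = E f(V) = f(0)`
    ∫ ω, f (U ω) ∂P = f 0 ∧
    ∫ ω, f (V ω) ∂P = f 0 := by
  have hd0 : 0 < d := by omega
  have hφ : Continuous fun y : UnitSphere d => f y :=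
    hf_cont.comp_continuous continuous_subtype_val fun y => sphere_subset_closedBall y.2
  have hQ' := transpose_mem_orthogonalGroup hQ
  -- Exchanging `U` and `V` replaces `Q` by `Q'`, so the second half is the first applied to `Q'`,
  -- with `Q'' = Q`.
  have hVU := hUV.symm
  refine ⟨condMean_bsDensity_of_harmonic hd0 hρ0 hρ1 hQ hf_C2 hf_cont hf_harm,
    integrable_comp_of_continuous hUV.measurable_snd hφ,
    hUV.condExp_comp_snd_of_harmonic hd0 hρ0 hρ1 hQ hf_C2 hf_cont hf_harm, fun v => ?_,
    integrable_comp_of_continuous hUV.measurable_fst hφ, ?_,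
    hUV.integral_comp_fst_of_harmonic hd0 hρ0 hρ1 hQ hf_C2 hf_cont hf_harm,
    hVU.integral_comp_fst_of_harmonic hd0 hρ0 hρ1 hQ' hf_C2 hf_cont hf_harm⟩
  · have h := condMean_bsDensity_of_harmonic hd0 hρ0 hρ1 hQ' hf_C2 hf_cont hf_harm v
    simpa only [show bsDensity ρ Q.transpose = fun y x => bsDensity ρ Q x y from
      funext₂ fun y x => bsDensity_transpose ρ Q x y, Matrix.transpose_transpose] using h
  · simpa only [Matrix.transpose_transpose] using
      hVU.condExp_comp_snd_of_harmonic hd0 hρ0 hρ1 hQ' hf_C2 hf_cont hf_harm
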